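/- Let $n,d\ge 1$ and let $\mathbb{K}=\mathbb{R}$ or $\mathbb{C}$. A \emph{matrix weight} is a locally integrable function $V:\mathbb{R}^n\to\mathbb{K}^{d\times d}$ whose values are (a.e.) Hermitian positive semidefinite. $Q$ denotes a cube in $\mathbb{R}^n$ with sides parallel to the axes, $|E|$ is Lebesgue measure, $\langle f\rangle_Q=\frac1{|Q|}\int_Q f\,dx$ is the average over $Q$ (entrywise for matrices), and for Hermitian matrices $A\ge B$ means that $A-B$ is positive semidefinite. A matrix weight $V$ is \emph{nondegenerate}, $V\in\mathcal{ND}$, if $\int_E V\,dx$ is positive definite for every measurable $E$ with $|E|>0$ on which $V$ is integrable. Define the following classes. * $V\in\mathcal{A}_{2,\infty}$: $V$ is a matrix weight such that for every $e\in\mathbb{K}^d\setminus\{0\}$ one has $e^*V(x)e>0$ for a.e. $x$, and there is $A_V>0$ such that for every cube $Q$, $\det\langle V\rangle_Q\le A_V\exp\langle\ln\det V\rangle_Q$ (where $\ln 0=-\infty$ and $\exp(-\infty)=0$). * $V\in\mathcal{A}_\infty$: $V$ is a matrix weight such that for every $\epsilon>0$ there is $\delta>0$ such that for every cube $Q$,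 $\left|\left\{x\in Q: V(x)\ge\delta\langle V\rangle_Q\right\}\right|\ge(1-\epsilon)|Q|$. * $V\in\mathcal{R}_{BM}$ (reverse Brunn–Minkowski): $V$ is a matrix weight and there is $B_V>0$ such that for every cube $Q$, $\left(\det\langle V\rangle_Q\right)^{1/d}\le B_V\left\langle(\det V)^{1/d}\right\rangle_Q$. * A scalar function $w$ on $\mathbb{R}^n$ is in $\mathrm{A}_\infty$ if it is locally integrable, positive a.e., and for every $\epsilon>0$ there is $\delta>0$ such that for every cube $Q$, $\left|\left\{x\in Q: w(x)\ge\delta\langle w\rangle_Q\right\}\right|\ge(1-\epsilon)|Q|$. If $V\in\mathcal{ND}$, then the following are equivalent: (a) $V\in\mathcal{A}_{2,\infty}$; (b) $V\in\mathcal{A}_\infty$; (c) $V\in\mathcal{R}_{BM}$ and $(\det V)^{1/d}\in\mathrm{A}_\infty$. In particular $\mathcal{A}_{2,\infty}=\mathcal{A}_\infty$ among nondegenerate matrix weights: $\mathcal{A}_{2,\infty}=\mathcal{ND}\cap\mathcal{A}_\infty$. -/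

import Mathlib

open MeasureTheory
open scoped ComplexOrder

namespace MatrixWeight

/-- The (closed) cube in `ℝⁿ` with centre `x` and side length `2 r`: the metric on `Fin n → ℝ` is
the `ℓ^∞` metric. It is a genuine cube when `0 < r`. -/
def cube {n : ℕ} (x : Fin n → ℝ) (r : ℝ) : Set (Fin n → ℝ) :=
  Metric.closedBall x r

variable {n d : ℕ} {𝕜 : Type*} [RCLike 𝕜]

/-- `V(E) = ∫_E V(y) dy`, computed entry by entry. -/
noncomputable def integralOn (V : (Fin n → ℝ) → Matrix (Fin d) (Fin d) 𝕜)
    (E : Set (Fin n → ℝ)) : Matrix (Fin d) (Fin d) 𝕜 :=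
  Matrix.of fun i j => ∫ y in E, V y i j

/-- The average `⨍_Q V(y) dy`, computed entry by entry. -/
noncomputable def averageOn (V : (Fin n → ℝ) → Matrix (Fin d) (Fin d) 𝕜)
    (Q : Set (Fin n → ℝ)) : Matrix (Fin d) (Fin d) 𝕜 :=
  Matrix.of fun i j => ⨍ y in Q, V y i j

/-- The determinant as a real number. It is used only for Hermitian matrices, whose determinant
is real. -/
noncomputable def realDet (A : Matrix (Fin d) (Fin d) 𝕜) : ℝ :=
  RCLike.re A.det

/-- `(det A)^{1/d}` for a positive semidefinite matrix `A`. -/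
noncomputable def detRoot (A : Matrix (Fin d) (Fin d) 𝕜) : ℝ :=
  realDet A ^ (1 / (d : ℝ))

/-- A matrix weight on `ℝⁿ`: a (real symmetric or complex) Hermitian positive semidefinite matrix
function that is locally integrable. All entries are locally integrable if and only if `V` is
measurable and its norm is locally integrable. -/
structure IsMatrixWeight (V : (Fin n → ℝ) → Matrix (Fin d) (Fin d) 𝕜) : Prop where
  posSemidef : ∀ᵐ x, (V x).PosSemidef
  locallyIntegrable : ∀ i j, LocallyIntegrable (fun x => V x i j)

/-- The nondegeneracy class: `V` is a matrix weight and `∫_E V` is positive definite for every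
measurable `E` with `|E| > 0`. Sets on which the integral is not finite are left out; they contain
bounded sets of positive measure, to which the condition applies. -/
structure IsND (V : (Fin n → ℝ) → Matrix (Fin d) (Fin d) 𝕜) : Prop where
  isMatrixWeight : IsMatrixWeight V
  posDef_integralOn : ∀ E : Set (Fin n → ℝ), MeasurableSet E → 0 < volume E →
    (∀ i j, IntegrableOn (fun x => V x i j) E) → (integralOn V E).PosDef

open Classical in
/-- `exp (⨍_Q ln f)` for a nonnegative `f`, with `ln 0 = -∞` and `exp (-∞) = 0`: the value is `0`
unless `f` is positive almost everywhere on `Q` and `ln f` is integrable on `Q`. (It is used for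
`f = det V` with `V` a matrix weight, for which the positive part of `ln f` is always integrable
on a cube, so that non-integrability means that the average of `ln f` is `-∞`.) -/
noncomputable def expAverageLog (f : (Fin n → ℝ) → ℝ) (Q : Set (Fin n → ℝ)) : ℝ :=
  if (∀ᵐ x ∂(volume.restrict Q), 0 < f x) ∧ IntegrableOn (fun x => Real.log (f x)) Q then
    Real.exp (⨍ x in Q, Real.log (f x))
  else 0

/-- The class `A_{2,∞}`: `V` is a 2-nondegenerate matrix weight, that is
`|V^{1/2}(x) e|² = ⟨V(x) e, e⟩ > 0` almost everywhere for every fixed `e ≠ 0`, and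
`det (⨍_Q V) ≤ A exp (⨍_Q ln det V)` for all cubes `Q`, with `A` independent of `Q`. -/
structure IsA2Inf (V : (Fin n → ℝ) → Matrix (Fin d) (Fin d) 𝕜) : Prop where
  isMatrixWeight : IsMatrixWeight V
  nondegenerate : ∀ e : Fin d → 𝕜, e ≠ 0 →
    ∀ᵐ x, 0 < RCLike.re (star e ⬝ᵥ (V x).mulVec e)
  det_le : ∃ A : ℝ, 0 < A ∧ ∀ (z : Fin n → ℝ) (r : ℝ), 0 < r →
    realDet (averageOn V (cube z r)) ≤ A * expAverageLog (fun x => realDet (V x)) (cube z r)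

/-- The class `A_∞` of matrix weights, in the sense of Dall'Ara. The condition `V(x) ≥ δ ⨍_Q V` is
meant in the order of Hermitian matrices. -/
structure IsAInf (V : (Fin n → ℝ) → Matrix (Fin d) (Fin d) 𝕜) : Prop where
  isMatrixWeight : IsMatrixWeight V
  measure_le : ∀ ε : ℝ, 0 < ε → ∃ δ : ℝ, 0 < δ ∧ ∀ (z : Fin n → ℝ) (r : ℝ), 0 < r →
    (1 - ε) * volume.real (cube z r) ≤
      volume.real {x ∈ cube z r | (V x - δ • averageOn V (cube z r)).PosSemidef}

/-- The reverse Brunn–Minkowski class. For a matrix weight `(det V)^{1/d}` is locally integrable,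
as it is at most `(tr V) / d`. -/
structure IsRBM (V : (Fin n → ℝ) → Matrix (Fin d) (Fin d) 𝕜) : Prop where
  isMatrixWeight : IsMatrixWeight V
  detRoot_le : ∃ B : ℝ, 0 < B ∧ ∀ (z : Fin n → ℝ) (r : ℝ), 0 < r →
    detRoot (averageOn V (cube z r)) ≤ B * ⨍ x in cube z r, detRoot (V x)

/-- The scalar class `A_∞`: `w` is a weight (locally integrable and positive almost everywhere),
and for every `ε > 0` there is `δ > 0` such that `w ≥ δ ⨍_Q w` on a part of `Q` of measure at
least `(1 - ε) |Q|`, for all cubes `Q`. -/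
structure IsScalarAInf (w : (Fin n → ℝ) → ℝ) : Prop where
  locallyIntegrable : LocallyIntegrable w
  pos : ∀ᵐ x, 0 < w x
  measure_le : ∀ ε : ℝ, 0 < ε → ∃ δ : ℝ, 0 < δ ∧ ∀ (z : Fin n → ℝ) (r : ℝ), 0 < r →
    (1 - ε) * volume.real (cube z r) ≤
      volume.real {x ∈ cube z r | δ * (⨍ y in cube z r, w y) ≤ w x}

end MatrixWeight

/-! Fix a cube `Q`, put `M = ⟨V⟩_Q`, and let `l i` be the eigenvalues of `V(x)` relative to `M`
(`exists_relative_eigenvalues`). Then `tr (M⁻¹V) = ∑ l i` has average `d` over `Q`, `det V / det M =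
∏ l i`, and `V ≥ δM` says that every `l i` is at least `δ`. The matrix statements thus become
statements about nonnegative numbers.

(a) ⇒ (b): `F = ∑ (l i - 1 - ln (l i))` is nonnegative, and its average `ln det M - ⟨ln det V⟩_Q` is
at most `ln A`. Where `V ≥ δM` fails, `F ≥ -1 - ln δ`, so Markov's inequality makes this set small.

(b) ⇒ (c): `V ≥ δM` forces `(det V)^{1/d} ≥ δ (det M)^{1/d}`. Integrating this over half of `Q`
gives reverse Brunn–Minkowski. With the AM–GM bound `⟨(det V)^{1/d}⟩_Q ≤ (det M)^{1/d}` it also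
gives scalar `A_∞`.

(c) ⇒ (a): scalar `A_∞` weights satisfy the reverse Jensen inequality `ln ⟨w⟩_Q - C ≤ ⟨ln w⟩_Q`
(`IsScalarAInf.average_log_ge`), which is combined with reverse Brunn–Minkowski after taking
logarithms. Reverse Jensen is the analytic core: a stopping-time argument bounds the integrals of
`ln` of the dyadic averages of `w` from below, uniformly in the generation, and Fatou's lemma passes
to the limit. -/

open Filter Topology

namespace MatrixWeight

/-! ### Subdivision of cubes -/

section Cube

variable {n : ℕ}

/-- The centre of the `s`-th of the `2 ^ n` cubes of half the size into which `cube z r` splits. -/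
noncomputable def childCenter (z : Fin n → ℝ) (r : ℝ) (s : Fin n → Bool) : Fin n → ℝ :=
  fun i => z i + if s i then r / 2 else -(r / 2)

/-- The index of a child of a cube with centre `z` that contains `x`. -/
noncomputable def childIndex (z x : Fin n → ℝ) : Fin n → Bool :=
  fun i => decide (z i ≤ x i)

lemma mem_cube_iff {z x : Fin n → ℝ} {r : ℝ} (hr : 0 ≤ r) :
    x ∈ cube z r ↔ ∀ i, |x i - z i| ≤ r := by
  simp only [cube, Metric.mem_closedBall, dist_pi_le_iff hr, Real.dist_eq]

lemma measurableSet_cube (z : Fin n → ℝ) (r : ℝ) : MeasurableSet (cube z r) :=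
  measurableSet_closedBall

lemma isCompact_cube (z : Fin n → ℝ) (r : ℝ) : IsCompact (cube z r) :=
  isCompact_closedBall z r

lemma volume_cube_ne_top (z : Fin n → ℝ) (r : ℝ) : volume (cube z r) ≠ ⊤ :=
  (isCompact_cube z r).measure_lt_top.ne

instance isFiniteMeasure_restrict_cube (z : Fin n → ℝ) (r : ℝ) :
    IsFiniteMeasure (volume.restrict (cube z r)) :=
  isFiniteMeasure_restrict.2 (volume_cube_ne_top z r)

lemma volume_real_cube (z : Fin n → ℝ) {r : ℝ} (hr : 0 ≤ r) :
    volume.real (cube z r) = (2 * r) ^ n := by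
  rw [measureReal_def, cube, Real.volume_pi_closedBall _ hr, ENNReal.toReal_ofReal (by positivity),
    Fintype.card_fin]

lemma volume_real_cube_pos (z : Fin n → ℝ) {r : ℝ} (hr : 0 < r) :
    0 < volume.real (cube z r) := by
  rw [volume_real_cube z hr.le]; positivity

lemma volume_cube_pos (z : Fin n → ℝ) {r : ℝ} (hr : 0 < r) : 0 < volume (cube z r) :=
  (ENNReal.toReal_pos_iff.1 (volume_real_cube_pos z hr)).1

lemma volume_real_child (z : Fin n → ℝ) {r : ℝ} (hr : 0 ≤ r) (s : Fin n → Bool) :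
    volume.real (cube (childCenter z r s) (r / 2)) = volume.real (cube z r) / 2 ^ n := by
  rw [volume_real_cube _ (by positivity), volume_real_cube _ hr, ← div_pow]
  congr 1; ring

lemma child_subset (z : Fin n → ℝ) {r : ℝ} (hr : 0 ≤ r) (s : Fin n → Bool) :
    cube (childCenter z r s) (r / 2) ⊆ cube z r := by
  intro x hx
  rw [mem_cube_iff (by positivity)] at hx
  rw [mem_cube_iff hr]
  intro i
  have h := abs_le.1 (hx i)
  simp only [childCenter] at h
  rw [abs_le]
  split_ifs at h <;> constructor <;> linarith

lemma mem_child_childIndex {z x : Fin n → ℝ} {r : ℝ} (hr : 0 ≤ r) (hx : x ∈ cube z r) :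
    x ∈ cube (childCenter z r (childIndex z x)) (r / 2) := by
  rw [mem_cube_iff hr] at hx
  rw [mem_cube_iff (by positivity)]
  intro i
  have h := abs_le.1 (hx i)
  simp only [childCenter, childIndex, decide_eq_true_eq, abs_le]
  split_ifs <;> constructor <;> linarith

lemma cube_eq_iUnion_child (z : Fin n → ℝ) {r : ℝ} (hr : 0 ≤ r) :
    cube z r = ⋃ s, cube (childCenter z r s) (r / 2) :=
  Set.Subset.antisymm (fun _ hx => Set.mem_iUnion.2 ⟨_, mem_child_childIndex hr hx⟩)
    (Set.iUnion_subset fun s => child_subset z hr s)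

lemma ae_coord_ne (z : Fin n → ℝ) : ∀ᵐ x : Fin n → ℝ, ∀ i, x i ≠ z i := by
  rw [ae_all_iff]
  intro i
  rw [ae_iff]
  simp only [ne_eq, not_not]
  exact Measure.pi_hyperplane (fun _ : Fin n => (volume : Measure ℝ)) i (z i)

lemma childIndex_eq {z x : Fin n → ℝ} {r : ℝ} (hr : 0 ≤ r) {s : Fin n → Bool}
    (hx : x ∈ cube (childCenter z r s) (r / 2)) (hne : ∀ i, x i ≠ z i) : childIndex z x = s := by
  rw [mem_cube_iff (by positivity)] at hx
  funext i
  have h := abs_le.1 (hx i)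
  simp only [childCenter] at h
  rcases hs : s i with _ | _
  · simp only [hs, Bool.false_eq_true, if_false] at h
    have : x i < z i := lt_of_le_of_ne (by linarith) (hne i)
    simpa [childIndex] using this
  · simp only [hs, if_true] at h
    have : z i ≤ x i := by linarith
    simpa [childIndex] using this

lemma ae_childIndex_eq (z : Fin n → ℝ) {r : ℝ} (hr : 0 ≤ r) (s : Fin n → Bool) :
    ∀ᵐ x ∂volume.restrict (cube (childCenter z r s) (r / 2)), childIndex z x = s := by
  rw [ae_restrict_iff' (measurableSet_cube _ _)]
  filter_upwards [ae_coord_ne z] with x hx hxc using childIndex_eq hr hxc hx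

/-- The closed children overlap only on the hyperplanes `x i = z i`, which are null. Additivity of
integrals, of integrability and of measure over children all come from this identity. -/
lemma restrict_cube_eq_sum (z : Fin n → ℝ) {r : ℝ} (hr : 0 ≤ r) :
    (volume : Measure (Fin n → ℝ)).restrict (cube z r) =
      ∑ s, volume.restrict (cube (childCenter z r s) (r / 2)) := by
  rw [cube_eq_iUnion_child z hr, Measure.restrict_iUnion_ae, Measure.sum_fintype]
  · intro s t hst
    refine measure_mono_null ?_ (ae_iff.1 (ae_coord_ne z))
    rintro x ⟨h1, h2⟩ hne
    exact hst ((childIndex_eq hr h1 hne).symm.trans (childIndex_eq hr h2 hne))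
  · exact fun s => (measurableSet_cube _ _).nullMeasurableSet

lemma integrableOn_cube_iff (z : Fin n → ℝ) {r : ℝ} (hr : 0 ≤ r) {f : (Fin n → ℝ) → ℝ} :
    IntegrableOn f (cube z r) ↔ ∀ s, IntegrableOn f (cube (childCenter z r s) (r / 2)) := by
  rw [IntegrableOn, restrict_cube_eq_sum z hr, integrable_finsetSum_measure]
  simp [IntegrableOn]

lemma integral_cube_eq_sum (z : Fin n → ℝ) {r : ℝ} (hr : 0 ≤ r) {f : (Fin n → ℝ) → ℝ}
    (hf : IntegrableOn f (cube z r)) :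
    ∫ x in cube z r, f x = ∑ s, ∫ x in cube (childCenter z r s) (r / 2), f x := by
  rw [restrict_cube_eq_sum z hr, integral_finsetSum_measure]
  exact fun s _ => (integrableOn_cube_iff z hr).1 hf s

lemma measureReal_inter_cube_eq_sum (z : Fin n → ℝ) {r : ℝ} (hr : 0 ≤ r) (S : Set (Fin n → ℝ)) :
    volume.real (S ∩ cube z r) = ∑ s, volume.real (S ∩ cube (childCenter z r s) (r / 2)) := by
  have h (c : Fin n → ℝ) (ρ : ℝ) :
      volume.real (S ∩ cube c ρ) = ((volume.restrict (cube c ρ)) S).toReal := by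
    rw [measureReal_def, Measure.restrict_apply' (measurableSet_cube _ _)]
  simp only [h]
  rw [restrict_cube_eq_sum z hr, Measure.finsetSum_apply, ENNReal.toReal_sum]
  exact fun s _ => measure_ne_top _ _

lemma volume_real_cube_eq_sum (z : Fin n → ℝ) {r : ℝ} (hr : 0 ≤ r) :
    volume.real (cube z r) = ∑ s, volume.real (cube (childCenter z r s) (r / 2)) := by
  simpa using measureReal_inter_cube_eq_sum z hr Set.univ

lemma setIntegral_cube_eq (f : (Fin n → ℝ) → ℝ) (z : Fin n → ℝ) {r : ℝ} (hr : 0 < r) :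
    ∫ x in cube z r, f x = volume.real (cube z r) * ⨍ x in cube z r, f x := by
  rw [setAverage_eq, smul_eq_mul, mul_inv_cancel_left₀ (volume_real_cube_pos z hr).ne']

lemma setAverage_pos {f : (Fin n → ℝ) → ℝ} (z : Fin n → ℝ) {r : ℝ} (hr : 0 < r)
    (hf : IntegrableOn f (cube z r)) (hpos : ∀ᵐ x ∂volume.restrict (cube z r), 0 < f x) :
    0 < ⨍ x in cube z r, f x := by
  rw [setAverage_eq]
  refine smul_pos (inv_pos.2 (volume_real_cube_pos z hr)) ?_
  rw [integral_pos_iff_support_of_nonneg_ae (hpos.mono fun _ h => h.le) hf]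
  have : (volume.restrict (cube z r)) (Function.support f)ᶜ = 0 :=
    measure_mono_null (fun x hx (h : 0 < f x) => hx h.ne') (ae_iff.1 hpos)
  rw [measure_of_measure_compl_eq_zero this, Measure.restrict_apply_univ]
  exact volume_cube_pos z hr

end Cube

/-! ### Dyadic averages -/

section Dyadic

variable {n : ℕ}

/-- The average of `w` over the cube of generation `m` below `cube z r` that contains `x`. -/
noncomputable def dyadicAverage (w : (Fin n → ℝ) → ℝ) :
    ℕ → (Fin n → ℝ) → ℝ → (Fin n → ℝ) → ℝ
  | 0, z, r, _ => ⨍ y in cube z r, w y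
  | m + 1, z, r, x => dyadicAverage w m (childCenter z r (childIndex z x)) (r / 2) x

lemma measurable_childIndex (z : Fin n → ℝ) : Measurable (childIndex z) := by
  refine measurable_pi_lambda _ fun i => ?_
  refine measurable_to_bool ?_
  have : (fun x : Fin n → ℝ => childIndex z x i) ⁻¹' {true} = {x | z i ≤ x i} := by
    ext x; simp [childIndex]
  rw [this]
  exact measurableSet_le measurable_const (measurable_pi_apply i)

lemma measurable_dyadicAverage (w : (Fin n → ℝ) → ℝ) (m : ℕ) (z : Fin n → ℝ) (r : ℝ) :
    Measurable (dyadicAverage w m z r) := by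
  induction m generalizing z r with
  | zero => exact measurable_const
  | succ m ih =>
    -- The child depends on `x` only through an index in a finite set, so measurability can be
    -- checked for each fixed index.
    have h : Measurable fun p : (Fin n → Bool) × (Fin n → ℝ) =>
        dyadicAverage w m (childCenter z r p.1) (r / 2) p.2 :=
      measurable_from_prod_countable_right fun s => ih (childCenter z r s) (r / 2)
    exact h.comp ((measurable_childIndex z).prodMk measurable_id)

lemma dyadicAverage_succ_ae_eq (w : (Fin n → ℝ) → ℝ) (m : ℕ) (z : Fin n → ℝ) {r : ℝ} (hr : 0 ≤ r)
    (s : Fin n → Bool) :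
    dyadicAverage w (m + 1) z r =ᵐ[volume.restrict (cube (childCenter z r s) (r / 2))]
      dyadicAverage w m (childCenter z r s) (r / 2) := by
  filter_upwards [ae_childIndex_eq z hr s] with x hx
  rw [dyadicAverage, hx]

/-- No regularity of `φ` is needed: the dyadic average is a.e. constant on each of finitely many
subcubes. -/
lemma integrableOn_comp_dyadicAverage (φ : ℝ → ℝ) (w : (Fin n → ℝ) → ℝ) (m : ℕ) (z : Fin n → ℝ)
    {r : ℝ} (hr : 0 < r) : IntegrableOn (fun x => φ (dyadicAverage w m z r x)) (cube z r) := by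
  induction m generalizing z r with
  | zero => exact integrable_const (μ := volume.restrict (cube z r)) (φ (⨍ y in cube z r, w y))
  | succ m ih =>
    rw [integrableOn_cube_iff z hr.le]
    intro s
    refine (ih (childCenter z r s) (half_pos hr)).congr ?_
    filter_upwards [dyadicAverage_succ_ae_eq w m z hr.le s] with x hx
    rw [hx]

lemma integral_comp_dyadicAverage_succ (φ : ℝ → ℝ) (w : (Fin n → ℝ) → ℝ) (m : ℕ)
    (z : Fin n → ℝ) {r : ℝ} (hr : 0 < r) :
    ∫ x in cube z r, φ (dyadicAverage w (m + 1) z r x) =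
      ∑ s, ∫ x in cube (childCenter z r s) (r / 2),
        φ (dyadicAverage w m (childCenter z r s) (r / 2) x) := by
  rw [integral_cube_eq_sum z hr.le (integrableOn_comp_dyadicAverage φ w (m + 1) z hr)]
  refine Finset.sum_congr rfl fun s _ => integral_congr_ae ?_
  filter_upwards [dyadicAverage_succ_ae_eq w m z hr.le s] with x hx
  rw [hx]

lemma integral_comp_dyadicAverage_zero (φ : ℝ → ℝ) (w : (Fin n → ℝ) → ℝ) (z : Fin n → ℝ) (r : ℝ) :
    ∫ x in cube z r, φ (dyadicAverage w 0 z r x) =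
      volume.real (cube z r) * φ (⨍ y in cube z r, w y) := by
  simp [dyadicAverage]

lemma integral_dyadicAverage {w : (Fin n → ℝ) → ℝ} (m : ℕ) (z : Fin n → ℝ) {r : ℝ} (hr : 0 < r)
    (hw : IntegrableOn w (cube z r)) :
    ∫ x in cube z r, dyadicAverage w m z r x = ∫ x in cube z r, w x := by
  induction m generalizing z r with
  | zero => rw [setIntegral_cube_eq w z hr]; exact integral_comp_dyadicAverage_zero id w z r
  | succ m ih =>
    rw [integral_cube_eq_sum z hr.le hw]
    refine (integral_comp_dyadicAverage_succ id w m z hr).trans (Finset.sum_congr rfl fun s _ => ?_)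
    exact ih _ (half_pos hr) ((integrableOn_cube_iff z hr.le).1 hw s)

lemma dyadicAverage_eq_average (w : (Fin n → ℝ) → ℝ) (m : ℕ) {z x : Fin n → ℝ} {r : ℝ}
    (hr : 0 ≤ r) (hx : x ∈ cube z r) :
    ∃ c, x ∈ cube c (r / 2 ^ m) ∧ dyadicAverage w m z r x = ⨍ y in cube c (r / 2 ^ m), w y := by
  induction m generalizing z r with
  | zero => exact ⟨z, by simpa using hx, by simp [dyadicAverage]⟩
  | succ m ih =>
    obtain ⟨c, hc, h⟩ := ih (by positivity : (0:ℝ) ≤ r / 2) (mem_child_childIndex hr hx)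
    have e : r / 2 / 2 ^ m = r / 2 ^ (m + 1) := by rw [pow_succ, div_div, mul_comm]
    rw [e] at hc h
    exact ⟨c, hc, h⟩

lemma ae_tendsto_dyadicAverage {w : (Fin n → ℝ) → ℝ} (hw : LocallyIntegrable w)
    (z : Fin n → ℝ) {r : ℝ} (hr : 0 < r) :
    ∀ᵐ x ∂volume.restrict (cube z r),
      Tendsto (fun m => dyadicAverage w m z r x) atTop (𝓝 (w x)) := by
  rw [ae_restrict_iff' (measurableSet_cube _ _)]
  -- Lebesgue differentiation along cubes that contain `x` without being centred there; the dilation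
  -- constant `1` suffices.
  filter_upwards [IsUnifLocDoublingMeasure.ae_tendsto_average volume hw 1] with x hx hxc
  choose c hc h using fun m => dyadicAverage_eq_average w m hr.le hxc
  simp only [h]
  refine hx c (fun m => r / 2 ^ m) ?_ (Eventually.of_forall fun m => by simpa [cube] using hc m)
  refine tendsto_nhdsWithin_iff.2 ⟨?_, Eventually.of_forall fun m => ?_⟩
  · simpa [div_eq_mul_inv] using
      (tendsto_pow_atTop_nhds_zero_of_lt_one (r := (2 : ℝ)⁻¹) (by norm_num)
        (by norm_num)).const_mul r
  · exact Set.mem_Ioi.2 (by positivity)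

end Dyadic

/-! ### Scalar `A_∞` weights satisfy the reverse Jensen inequality -/

section Scalar

variable {n : ℕ} {w : (Fin n → ℝ) → ℝ}

lemma integrableOn_cube_of_locallyIntegrable {E : Type*} [NormedAddCommGroup E]
    {f : (Fin n → ℝ) → E} (hf : LocallyIntegrable f) (z : Fin n → ℝ) (r : ℝ) :
    IntegrableOn f (cube z r) :=
  hf.integrableOn_isCompact (isCompact_cube z r)

lemma nullMeasurableSet_ge (hw : LocallyIntegrable w) (c : ℝ) :
    NullMeasurableSet {x | c ≤ w x} :=
  nullMeasurableSet_le aemeasurable_const hw.aestronglyMeasurable.aemeasurable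

lemma measureReal_lt_add_ge (hw : LocallyIntegrable w) (c : ℝ) (z : Fin n → ℝ) (r : ℝ) :
    volume.real ({x | c ≤ w x} ∩ cube z r) + volume.real ({x | w x < c} ∩ cube z r) =
      volume.real (cube z r) := by
  rw [← measureReal_inter_add_sdiff₀ (nullMeasurableSet_ge hw c) (volume_cube_ne_top z r),
    Set.inter_comm]
  congr 2
  ext x
  simp [and_comm]

lemma mul_measureReal_ge_le_integral (hw : LocallyIntegrable w) (hpos : ∀ᵐ x, 0 < w x) (c : ℝ)
    (z : Fin n → ℝ) (r : ℝ) :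
    c * volume.real ({x | c ≤ w x} ∩ cube z r) ≤ ∫ x in cube z r, w x := by
  have := mul_meas_ge_le_integral_of_nonneg
    ((ae_restrict_of_ae hpos).mono fun _ h => h.le : 0 ≤ᵐ[volume.restrict (cube z r)] w)
    (integrableOn_cube_of_locallyIntegrable hw z r) c
  rwa [measureReal_def, Measure.restrict_apply' (measurableSet_cube _ _)] at this

lemma setAverage_pos_of_ae_pos (hw : LocallyIntegrable w) (hpos : ∀ᵐ x, 0 < w x)
    (z : Fin n → ℝ) {r : ℝ} (hr : 0 < r) : 0 < ⨍ x in cube z r, w x :=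
  setAverage_pos z hr (integrableOn_cube_of_locallyIntegrable hw z r) (ae_restrict_of_ae hpos)

/-- Chebyshev: `w ≥ 2 l` holds on at most half of the cube. This charges each stopping cube to the
sublevel set `{w < 2 l}`. -/
lemma volume_real_le_of_average_le (hw : LocallyIntegrable w) (hpos : ∀ᵐ x, 0 < w x) {l : ℝ}
    (hl : 0 < l) (z : Fin n → ℝ) {r : ℝ} (hr : 0 < r) (h : ⨍ x in cube z r, w x ≤ l) :
    volume.real (cube z r) ≤ 2 * volume.real ({x | w x < 2 * l} ∩ cube z r) := by
  have h1 := measureReal_lt_add_ge hw (2 * l) z r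
  have h2 := mul_measureReal_ge_le_integral hw hpos (2 * l) z r
  rw [setIntegral_cube_eq w z hr] at h2
  have h3 : l * (2 * volume.real ({x | 2 * l ≤ w x} ∩ cube z r)) ≤ l * volume.real (cube z r) := by
    nlinarith [volume_real_cube_pos z hr]
  have h4 := le_of_mul_le_mul_left h3 hl
  linarith

lemma measureReal_lt_le_of_isScalarAInf (h : IsScalarAInf w) {ε : ℝ} (hε : 0 < ε) :
    ∃ δ : ℝ, 0 < δ ∧ δ ≤ 1 ∧ ∀ (z : Fin n → ℝ) (r : ℝ), 0 < r →
      volume.real ({x | w x < δ * ⨍ y in cube z r, w y} ∩ cube z r) ≤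
        ε * volume.real (cube z r) := by
  obtain ⟨δ, hδ, H⟩ := h.measure_le ε hε
  refine ⟨min δ 1, by positivity, min_le_right _ _, fun z r hr => ?_⟩
  have h1 := H z r hr
  have h2 := measureReal_lt_add_ge h.locallyIntegrable (δ * ⨍ y in cube z r, w y) z r
  have h3 : {x ∈ cube z r | δ * (⨍ y in cube z r, w y) ≤ w x} =
      {x | δ * (⨍ y in cube z r, w y) ≤ w x} ∩ cube z r := by
    ext x; simp [and_comm]
  rw [h3] at h1
  have h4 : volume.real ({x | w x < min δ 1 * ⨍ y in cube z r, w y} ∩ cube z r) ≤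
      volume.real ({x | w x < δ * ⨍ y in cube z r, w y} ∩ cube z r) := by
    refine measureReal_mono (Set.inter_subset_inter_left _ fun x hx => ?_)
      (measure_ne_top_of_subset Set.inter_subset_right (volume_cube_ne_top z r))
    exact lt_of_lt_of_le hx (mul_le_mul_of_nonneg_right (min_le_left _ _)
      (setAverage_pos_of_ae_pos h.locallyIntegrable h.pos z hr).le)
  linarith

/-! ### Stopping-time bound for the logarithm of dyadic averages, and its limit. -/

variable {δ : ℝ}

/-- The exceptional set has measure at most a quarter of that of one child, so `w ≥ δ ⟨w⟩_Q` on more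
than half of each child. Averages therefore drop by a bounded factor at each generation. -/
lemma average_child_ge (hw : LocallyIntegrable w) (hpos : ∀ᵐ x, 0 < w x) (hδ : 0 < δ)
    (H : ∀ (z : Fin n → ℝ) (r : ℝ), 0 < r →
      volume.real ({x | w x < δ * ⨍ y in cube z r, w y} ∩ cube z r) ≤
        (1 / 4 / 2 ^ n) * volume.real (cube z r))
    (z : Fin n → ℝ) {r : ℝ} (hr : 0 < r) (s : Fin n → Bool) :
    δ / 2 * (⨍ x in cube z r, w x) ≤ ⨍ x in cube (childCenter z r s) (r / 2), w x := by
  have hA := setAverage_pos_of_ae_pos hw hpos z hr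
  set A := ⨍ x in cube z r, w x with hAdef
  set c := childCenter z r s
  have hc := volume_real_cube_pos c (half_pos hr)
  have h1 : volume.real ({x | w x < δ * A} ∩ cube c (r / 2)) ≤ 1 / 4 * volume.real (cube c (r / 2)) := by
    calc volume.real ({x | w x < δ * A} ∩ cube c (r / 2))
        ≤ volume.real ({x | w x < δ * A} ∩ cube z r) :=
          measureReal_mono (Set.inter_subset_inter_right _ (child_subset z hr.le s))
            (measure_ne_top_of_subset Set.inter_subset_right (volume_cube_ne_top z r))
      _ ≤ (1 / 4 / 2 ^ n) * volume.real (cube z r) := H z r hr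
      _ = 1 / 4 * volume.real (cube c (r / 2)) := by
          rw [volume_real_child z hr.le s]; ring
  have h2 := measureReal_lt_add_ge hw (δ * A) c (r / 2)
  have h3 := mul_measureReal_ge_le_integral hw hpos (δ * A) c (r / 2)
  rw [setIntegral_cube_eq w c (half_pos hr)] at h3
  have h4 : volume.real (cube c (r / 2)) / 2 ≤ volume.real ({x | δ * A ≤ w x} ∩ cube c (r / 2)) := by
    linarith
  have h5 := mul_le_mul_of_nonneg_left h4 (mul_pos hδ hA).le
  refine le_of_mul_le_mul_left (le_trans (le_of_eq ?_) (h5.trans h3)) hc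
  ring

/-- Below a cube on which the average of `w` exceeds `l`, stop at the first cubes on which the
average is at most `l`. -/
lemma integral_log_dyadicAverage_ge_of_lt (hw : LocallyIntegrable w) (hpos : ∀ᵐ x, 0 < w x)
    (hδ : 0 < δ) (hδ1 : δ ≤ 1)
    (H : ∀ (z : Fin n → ℝ) (r : ℝ), 0 < r →
      volume.real ({x | w x < δ * ⨍ y in cube z r, w y} ∩ cube z r) ≤
        (1 / 4 / 2 ^ n) * volume.real (cube z r))
    {C : ℝ} (hC : 0 ≤ C) {l : ℝ} (hl : 0 < l) (m : ℕ)
    (ih : ∀ j < m, ∀ (z : Fin n → ℝ) (r : ℝ), 0 < r →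
      volume.real (cube z r) * (Real.log (⨍ y in cube z r, w y) - C) ≤
        ∫ x in cube z r, Real.log (dyadicAverage w j z r x))
    (z : Fin n → ℝ) {r : ℝ} (hr : 0 < r) (hlt : l < ⨍ y in cube z r, w y) :
    volume.real (cube z r) * Real.log l -
        2 * (C + Real.log (2 / δ)) * volume.real ({x | w x < 2 * l} ∩ cube z r) ≤
      ∫ x in cube z r, Real.log (dyadicAverage w m z r x) := by
  have hlog : 0 ≤ Real.log (2 / δ) := Real.log_nonneg (by rw [le_div_iff₀ hδ]; linarith)
  induction m generalizing z r with
  | zero =>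
    rw [integral_comp_dyadicAverage_zero Real.log]
    have h1 := mul_le_mul_of_nonneg_left (Real.log_le_log hl hlt.le) (volume_real_cube_pos z hr).le
    have h2 : 0 ≤ 2 * (C + Real.log (2 / δ)) * volume.real ({x | w x < 2 * l} ∩ cube z r) := by
      positivity
    linarith
  | succ m ihm =>
    rw [integral_comp_dyadicAverage_succ Real.log w m z hr, volume_real_cube_eq_sum z hr.le,
      measureReal_inter_cube_eq_sum z hr.le, Finset.sum_mul, Finset.mul_sum,
      ← Finset.sum_sub_distrib]
    refine Finset.sum_le_sum fun s _ => ?_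
    rcases lt_or_ge l (⨍ y in cube (childCenter z r s) (r / 2), w y) with hs | hs
    · exact ihm (fun j hj => ih j (hj.trans (Nat.lt_succ_self m))) _ (half_pos hr) hs
    -- A stopping cube: the outer hypothesis handles the remaining `m` generations. Its parent has
    -- average above `l`, so its own is at least `l / (2 / δ)`, and the loss relative to `log l` is
    -- at most `C + log (2 / δ)` per unit volume.
    · refine le_trans ?_ (ih m (Nat.lt_succ_self m) _ _ (half_pos hr))
      have h1 := average_child_ge hw hpos hδ H z hr s
      have h2 := volume_real_le_of_average_le hw hpos hl _ (half_pos hr) hs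
      have h3 : l / (2 / δ) ≤ ⨍ y in cube (childCenter z r s) (r / 2), w y := by
        refine le_trans (le_of_eq ?_) ((mul_le_mul_of_nonneg_left hlt.le (half_pos hδ).le).trans h1)
        field_simp
      have h4 := Real.log_le_log (by positivity) h3
      rw [Real.log_div hl.ne' (by positivity)] at h4
      have h5 := mul_le_mul_of_nonneg_left h4
        (volume_real_cube_pos (childCenter z r s) (half_pos hr)).le
      have h6 := mul_le_mul_of_nonneg_left h2 (add_nonneg hC hlog)
      nlinarith

lemma integral_log_dyadicAverage_ge (hw : LocallyIntegrable w) (hpos : ∀ᵐ x, 0 < w x)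
    (hδ : 0 < δ) (hδ1 : δ ≤ 1)
    (H : ∀ (z : Fin n → ℝ) (r : ℝ), 0 < r →
      volume.real ({x | w x < δ * ⨍ y in cube z r, w y} ∩ cube z r) ≤
        (1 / 4 / 2 ^ n) * volume.real (cube z r))
    (m : ℕ) (z : Fin n → ℝ) {r : ℝ} (hr : 0 < r) :
    volume.real (cube z r) * (Real.log (⨍ y in cube z r, w y) - 3 * Real.log (2 / δ)) ≤
      ∫ x in cube z r, Real.log (dyadicAverage w m z r x) := by
  have hlog : 0 ≤ Real.log (2 / δ) := Real.log_nonneg (by rw [le_div_iff₀ hδ]; linarith)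
  induction m using Nat.strong_induction_on generalizing z r with
  | _ m ih =>
    have hA := setAverage_pos_of_ae_pos hw hpos z hr
    have hv := volume_real_cube_pos z hr
    -- With this level `l`, `2 l = δ ⟨w⟩_Q`, so `{w < 2 l}` fills at most a quarter of `Q`. Writing
    -- `K = log (2 / δ)`, the total loss is at most `K + 2 (C + K) / 4`, which equals `C` exactly
    -- when `C = 3 K`.
    have hl : 0 < (⨍ y in cube z r, w y) / (2 / δ) := by positivity
    have hlt : (⨍ y in cube z r, w y) / (2 / δ) < ⨍ y in cube z r, w y := by
      refine div_lt_self hA ?_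
      rw [lt_div_iff₀ hδ]; linarith
    have h1 := integral_log_dyadicAverage_ge_of_lt hw hpos hδ hδ1 H
      (C := 3 * Real.log (2 / δ)) (by positivity) hl m (fun j hj z r hr => ih j hj z hr) z hr hlt
    rw [Real.log_div hA.ne' (by positivity)] at h1
    refine le_trans ?_ h1
    have h2 := H z r hr
    have h3 : 2 * ((⨍ y in cube z r, w y) / (2 / δ)) = δ * ⨍ y in cube z r, w y := by
      field_simp
    rw [h3]
    have h4 : (1 / 4 / 2 ^ n : ℝ) ≤ 1 / 4 :=
      div_le_self (by norm_num) (one_le_pow₀ (by norm_num))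
    have h5 := h2.trans (mul_le_mul_of_nonneg_right h4 hv.le)
    have h6 := mul_le_mul_of_nonneg_left h5 hlog
    linarith

/-- Fatou is applied to `t - log t`, which is nonnegative for `t > 0`. The linear term costs
nothing, since dyadic averaging preserves the integral of `w`; finiteness of the limit also yields
integrability of `log w`. -/
lemma average_log_ge (hw : LocallyIntegrable w) (hpos : ∀ᵐ x, 0 < w x) {C : ℝ}
    (z : Fin n → ℝ) {r : ℝ} (hr : 0 < r)
    (H : ∀ m, volume.real (cube z r) * (Real.log (⨍ y in cube z r, w y) - C) ≤
      ∫ x in cube z r, Real.log (dyadicAverage w m z r x)) :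
    IntegrableOn (fun x => Real.log (w x)) (cube z r) ∧
      Real.log (⨍ y in cube z r, w y) - C ≤ ⨍ x in cube z r, Real.log (w x) := by
  have hwQ := integrableOn_cube_of_locallyIntegrable hw z r
  have hv := volume_real_cube_pos z hr
  have hposQ : ∀ᵐ x ∂volume.restrict (cube z r), 0 < w x := ae_restrict_of_ae hpos
  set T := (∫ x in cube z r, w x) -
    volume.real (cube z r) * (Real.log (⨍ y in cube z r, w y) - C) with hT
  have hnn (t : ℝ) (ht : 0 < t) : 0 ≤ t - Real.log t := by
    linarith [Real.log_le_sub_one_of_pos ht]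
  have hbound (m : ℕ) : ∫⁻ x in cube z r,
      ENNReal.ofReal (dyadicAverage w m z r x - Real.log (dyadicAverage w m z r x)) ≤
        ENNReal.ofReal T := by
    have hi1 := integrableOn_comp_dyadicAverage (fun t => t) w m z hr
    have hi2 := integrableOn_comp_dyadicAverage Real.log w m z hr
    rw [← ofReal_integral_eq_lintegral_ofReal
      (integrableOn_comp_dyadicAverage (fun t => t - Real.log t) w m z hr)]
    · refine ENNReal.ofReal_le_ofReal ?_
      have h := integral_sub hi1 hi2
      have h' := integral_dyadicAverage m z hr hwQ
      rw [h, h']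
      exact sub_le_sub_left (H m) _
    · rw [EventuallyLE, ae_restrict_iff' (measurableSet_cube _ _)]
      refine Eventually.of_forall fun x hx => ?_
      obtain ⟨c, -, hc⟩ := dyadicAverage_eq_average w m hr.le hx
      refine hnn _ ?_
      rw [hc]
      exact setAverage_pos_of_ae_pos hw hpos c (by positivity)
  have hfatou : ∫⁻ x in cube z r, ENNReal.ofReal (w x - Real.log (w x)) ≤ ENNReal.ofReal T := by
    calc ∫⁻ x in cube z r, ENNReal.ofReal (w x - Real.log (w x))
        = ∫⁻ x in cube z r, liminf (fun m => ENNReal.ofReal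
            (dyadicAverage w m z r x - Real.log (dyadicAverage w m z r x))) atTop := by
          refine lintegral_congr_ae ?_
          filter_upwards [ae_tendsto_dyadicAverage hw z hr, hposQ] with x hx hx0
          exact (ENNReal.tendsto_ofReal (hx.sub (hx.log hx0.ne'))).liminf_eq.symm
      _ ≤ liminf (fun m => ∫⁻ x in cube z r, ENNReal.ofReal
            (dyadicAverage w m z r x - Real.log (dyadicAverage w m z r x))) atTop := by
          refine lintegral_liminf_le' fun m => ?_
          have := measurable_dyadicAverage w m z r
          fun_prop
      _ ≤ ENNReal.ofReal T := by
          refine liminf_le_of_le (by isBoundedDefault) fun b hb => ?_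
          obtain ⟨m, hm⟩ := hb.exists
          exact hm.trans (hbound m)
  have hnnQ : 0 ≤ᵐ[volume.restrict (cube z r)] fun x => w x - Real.log (w x) :=
    hposQ.mono fun x hx => hnn _ hx
  have hmeas : AEStronglyMeasurable (fun x => w x - Real.log (w x))
      (volume.restrict (cube z r)) :=
    (hwQ.aestronglyMeasurable.aemeasurable.sub
      hwQ.aestronglyMeasurable.aemeasurable.log).aestronglyMeasurable
  have hint : IntegrableOn (fun x => w x - Real.log (w x)) (cube z r) :=
    ⟨hmeas, (hasFiniteIntegral_iff_ofReal hnnQ).2 (hfatou.trans_lt ENNReal.ofReal_lt_top)⟩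
  have hlogint : IntegrableOn (fun x => Real.log (w x)) (cube z r) := by
    refine (hwQ.sub hint).congr (Eventually.of_forall fun x => ?_)
    simp
  refine ⟨hlogint, ?_⟩
  have hle : ∫ x in cube z r, (w x - Real.log (w x)) ≤ T := by
    -- `ENNReal.ofReal` truncates at zero, so the sign of `T` is needed; it follows from generation
    -- `0`.
    have hT0 : 0 ≤ T := by
      have h1 := H 0
      rw [integral_comp_dyadicAverage_zero Real.log] at h1
      have h2 := hnn _ (setAverage_pos_of_ae_pos hw hpos z hr)
      rw [hT, setIntegral_cube_eq w z hr]
      nlinarith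
    rw [← ENNReal.ofReal_le_ofReal_iff hT0, ofReal_integral_eq_lintegral_ofReal hint hnnQ]
    exact hfatou
  rw [integral_sub hwQ hlogint, hT, setIntegral_cube_eq (fun x => Real.log (w x)) z hr] at hle
  exact le_of_mul_le_mul_left (by linarith) hv

/-- The reverse Jensen inequality for a scalar `A_∞` weight. -/
theorem IsScalarAInf.average_log_ge (h : IsScalarAInf w) :
    ∃ C : ℝ, ∀ (z : Fin n → ℝ) (r : ℝ), 0 < r →
      IntegrableOn (fun x => Real.log (w x)) (cube z r) ∧
        Real.log (⨍ y in cube z r, w y) - C ≤ ⨍ x in cube z r, Real.log (w x) := by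
  obtain ⟨δ, hδ, hδ1, H⟩ := measureReal_lt_le_of_isScalarAInf h
    (ε := 1 / 4 / 2 ^ n) (by positivity)
  exact ⟨3 * Real.log (2 / δ), fun z r hr =>
    MatrixWeight.average_log_ge h.locallyIntegrable h.pos z hr fun m =>
      integral_log_dyadicAverage_ge h.locallyIntegrable h.pos hδ hδ1 H m z hr⟩

end Scalar

/-! ### Relative eigenvalues of positive semidefinite matrices -/

section Matrices

open Matrix
open scoped MatrixOrder

variable {d : ℕ} {𝕜 : Type*} [RCLike 𝕜] {M V : Matrix (Fin d) (Fin d) 𝕜}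

lemma exists_conjTranspose_mul_mul_eq_one (hM : M.PosDef) :
    ∃ S : Matrix (Fin d) (Fin d) 𝕜, IsUnit S ∧ Sᴴ * M * S = 1 := by
  obtain ⟨B, hB⟩ := CStarAlgebra.nonneg_iff_eq_star_mul_self.1 (nonneg_iff_posSemidef.2 hM.posSemidef)
  rw [star_eq_conjTranspose] at hB
  have hBu : IsUnit B := by
    have := (isUnit_iff_isUnit_det _).1 hM.isUnit
    rw [hB, det_mul] at this
    exact (isUnit_iff_isUnit_det _).2 (isUnit_of_mul_isUnit_right this)
  have hdet := (isUnit_iff_isUnit_det _).1 hBu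
  refine ⟨B⁻¹, by rwa [isUnit_nonsing_inv_iff], ?_⟩
  rw [hB, conjTranspose_nonsing_inv, ← Matrix.mul_assoc,
    nonsing_inv_mul _ (by simpa [det_conjTranspose] using hdet.star), Matrix.one_mul,
    mul_nonsing_inv _ hdet]

lemma posSemidef_sub_smul_one_iff {W : Matrix (Fin d) (Fin d) 𝕜} (hW : W.IsHermitian) (δ : ℝ) :
    (W - δ • (1 : Matrix (Fin d) (Fin d) 𝕜)).PosSemidef ↔ ∀ i, δ ≤ hW.eigenvalues i := by
  set U : Matrix (Fin d) (Fin d) 𝕜 := hW.eigenvectorUnitary.1 with hU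
  have hUU : U * star U = 1 := Unitary.coe_mul_star_self _
  have hUu : IsUnit U := IsUnit.of_mul_eq_one _ hUU
  have h : W - δ • (1 : Matrix (Fin d) (Fin d) 𝕜) =
      U * diagonal (fun i => ((hW.eigenvalues i - δ : ℝ) : 𝕜)) * star U := by
    have e : diagonal (fun i => ((hW.eigenvalues i - δ : ℝ) : 𝕜)) =
        diagonal (RCLike.ofReal ∘ hW.eigenvalues) - δ • (1 : Matrix (Fin d) (Fin d) 𝕜) := by
      ext i j
      by_cases hij : i = j
      · subst hij; simp [RCLike.real_smul_eq_coe_mul]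
      · simp [hij]
    rw [e, Matrix.mul_sub, Matrix.sub_mul, Matrix.mul_smul, Matrix.smul_mul, Matrix.mul_one, hUU]
    congr 1
    conv_lhs => rw [hW.spectral_theorem]
    rfl
  rw [h, IsUnit.posSemidef_star_right_conjugate_iff hUu, posSemidef_diagonal_iff]
  simp [sub_nonneg]

/-- Simultaneous diagonalization: `l` are the eigenvalues of `V` relative to `M`. -/
lemma exists_relative_eigenvalues (hM : M.PosDef) (hV : V.PosSemidef) :
    ∃ l : Fin d → ℝ, (∀ i, 0 ≤ l i) ∧ ∑ i, l i = RCLike.re (M⁻¹ * V).trace ∧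
      realDet V = realDet M * ∏ i, l i ∧
      ∀ δ : ℝ, (V - δ • M).PosSemidef ↔ ∀ i, δ ≤ l i := by
  obtain ⟨S, hSu, hS⟩ := exists_conjTranspose_mul_mul_eq_one hM
  have hW : (Sᴴ * V * S).PosSemidef := hV.conjTranspose_mul_mul_same S
  -- By cyclicity of the trace, this turns `tr (Sᴴ V S)` into `tr (M⁻¹ V)`.
  have hinv : S * Sᴴ = M⁻¹ := by
    refine (inv_eq_left_inv ?_).symm
    have h1 : S * (Sᴴ * M) = 1 := mul_eq_one_comm.1 hS
    rw [Matrix.mul_assoc, h1]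
  refine ⟨hW.1.eigenvalues, hW.eigenvalues_nonneg, ?_, ?_, fun δ => ?_⟩
  · have h := hW.1.trace_eq_sum_eigenvalues
    rw [Matrix.trace_mul_comm, ← Matrix.mul_assoc, hinv] at h
    rw [h, ← RCLike.ofReal_sum, RCLike.ofReal_re]
  · have h := hW.1.det_eq_prod_eigenvalues
    have h2 : V.det = M.det * (Sᴴ * V * S).det := by
      have h3 := congrArg det hS
      simp only [det_mul, det_one] at h3 ⊢
      linear_combination (-V.det) * h3
    rw [h, ← RCLike.ofReal_prod] at h2
    rw [realDet, h2, mul_comm, RCLike.re_ofReal_mul, mul_comm, realDet]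
  · rw [← posSemidef_sub_smul_one_iff hW.1, ← hS, ← Matrix.smul_mul, ← Matrix.mul_smul,
      ← Matrix.sub_mul, ← Matrix.mul_sub]
    exact (IsUnit.posSemidef_star_left_conjugate_iff hSu).symm

lemma realDet_pos (hM : M.PosDef) : 0 < realDet M :=
  (RCLike.pos_iff.1 hM.det_pos).1

lemma realDet_nonneg (hV : V.PosSemidef) : 0 ≤ realDet V :=
  (RCLike.nonneg_iff.1 hV.det_nonneg).1

lemma detRoot_nonneg (hV : V.PosSemidef) : 0 ≤ detRoot V :=
  Real.rpow_nonneg (realDet_nonneg hV) _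

lemma detRoot_pos (hM : M.PosDef) : 0 < detRoot M :=
  Real.rpow_pos_of_pos (realDet_pos hM) _

lemma detRoot_one : detRoot (1 : Matrix (Fin d) (Fin d) 𝕜) = 1 := by
  simp [detRoot, realDet]

lemma posDef_of_sub_smul (hM : M.PosDef) {δ : ℝ} (hδ : 0 < δ) (h : (V - δ • M).PosSemidef) :
    V.PosDef := by
  have h1 : (δ • M).PosDef := by
    have := hM.smul (a := δ) hδ
    exact this
  simpa using h1.posSemidef_add h

lemma mul_detRoot_le (hd : 1 ≤ d) (hM : M.PosDef) {δ : ℝ} (hδ : 0 < δ)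
    (h : (V - δ • M).PosSemidef) : δ * detRoot M ≤ detRoot V := by
  obtain ⟨l, hl0, -, hdet, hl⟩ :=
    exists_relative_eigenvalues hM (posDef_of_sub_smul hM hδ h).posSemidef
  have h1 : δ ^ d ≤ ∏ i, l i := by
    simpa using Finset.prod_le_prod (s := Finset.univ) (fun _ _ => hδ.le) fun i _ => (hl δ).1 h i
  have hd0 : d ≠ 0 := by omega
  have h2 : δ = (δ ^ d) ^ (1 / (d : ℝ)) := by
    rw [one_div, Real.pow_rpow_inv_natCast hδ.le hd0]
  rw [detRoot, detRoot, hdet, mul_comm, Real.mul_rpow (realDet_pos hM).le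
    (Finset.prod_nonneg fun i _ => hl0 i)]
  refine mul_le_mul_of_nonneg_left ?_ (detRoot_pos hM).le
  rw [h2]
  exact Real.rpow_le_rpow (by positivity) h1 (by positivity)

/-- The inequality of arithmetic and geometric means for the relative eigenvalues. -/
lemma detRoot_le_mul_trace (hd : 1 ≤ d) (hM : M.PosDef) (hV : V.PosSemidef) :
    detRoot V ≤ detRoot M * (RCLike.re (M⁻¹ * V).trace / d) := by
  obtain ⟨l, hl0, htr, hdet, -⟩ := exists_relative_eigenvalues hM hV
  rw [detRoot, detRoot, hdet, Real.mul_rpow (realDet_pos hM).le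
    (Finset.prod_nonneg fun i _ => hl0 i), ← htr]
  refine mul_le_mul_of_nonneg_left ?_ (detRoot_pos hM).le
  have := Real.geom_mean_le_arith_mean Finset.univ (fun _ => 1) l (fun _ _ => zero_le_one)
    (by simp; omega) fun i _ => hl0 i
  simpa using this

/-- Hadamard-type inequality `d ≤ tr (M⁻¹ V) - ln det (M⁻¹ V)`, with its quantitative form when
`V ≥ δ M` fails. -/
lemma trace_sub_log_det_ge (hM : M.PosDef) (hV : V.PosSemidef) (hpos : 0 < realDet V) :
    0 ≤ RCLike.re (M⁻¹ * V).trace - (Real.log (realDet V) - Real.log (realDet M)) - d ∧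
      ∀ δ : ℝ, 0 < δ → ¬ (V - δ • M).PosSemidef →
        -1 - Real.log δ ≤
          RCLike.re (M⁻¹ * V).trace - (Real.log (realDet V) - Real.log (realDet M)) - d := by
  obtain ⟨l, hl0, htr, hdet, hl⟩ := exists_relative_eigenvalues hM hV
  have hM0 := realDet_pos hM
  have hprod : ∏ i, l i ≠ 0 := fun h => by rw [hdet, h, mul_zero] at hpos; exact hpos.false
  have hl1 (i) : 0 < l i := lt_of_le_of_ne (hl0 i) (Finset.prod_ne_zero_iff.1 hprod i (by simp)).symm
  have e : RCLike.re (M⁻¹ * V).trace - (Real.log (realDet V) - Real.log (realDet M)) - d =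
      ∑ i, (l i - 1 - Real.log (l i)) := by
    rw [hdet, Real.log_mul hM0.ne' hprod, Real.log_prod fun i _ => (hl1 i).ne', ← htr]
    simp only [Finset.sum_sub_distrib, Finset.sum_const, Finset.card_univ, Fintype.card_fin,
      nsmul_eq_mul, mul_one]
    ring
  have hnn (i) : 0 ≤ l i - 1 - Real.log (l i) := by linarith [Real.log_le_sub_one_of_pos (hl1 i)]
  rw [e]
  refine ⟨Finset.sum_nonneg fun i _ => hnn i, fun δ hδ h => ?_⟩
  rw [hl] at h
  push Not at h
  obtain ⟨i, hi⟩ := h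
  refine le_trans ?_ (Finset.single_le_sum (fun j _ => hnn j) (Finset.mem_univ i))
  have := Real.log_le_log (hl1 i) hi.le
  linarith [hl1 i]

end Matrices

/-! ### Integrals of matrix weights -/

section Integrals

open Matrix

variable {n d : ℕ} {𝕜 : Type*} [RCLike 𝕜] {V : (Fin n → ℝ) → Matrix (Fin d) (Fin d) 𝕜}

lemma IsMatrixWeight.integrableOn_cube (hV : IsMatrixWeight V) (z : Fin n → ℝ) (r : ℝ)
    (i j : Fin d) : IntegrableOn (fun x => V x i j) (cube z r) :=
  integrableOn_cube_of_locallyIntegrable (hV.locallyIntegrable i j) z r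

lemma IsMatrixWeight.aemeasurable_realDet (hV : IsMatrixWeight V) :
    AEMeasurable fun x => realDet (V x) := by
  have h : AEStronglyMeasurable (fun x => (V x).det) := by
    simp only [Matrix.det_apply']
    refine Finset.aestronglyMeasurable_fun_sum _ fun σ _ => ?_
    refine aestronglyMeasurable_const.mul ?_
    exact Finset.aestronglyMeasurable_fun_prod _ fun i _ =>
      (hV.locallyIntegrable _ _).aestronglyMeasurable
  exact (RCLike.continuous_re.comp_aestronglyMeasurable h).aemeasurable

lemma IsMatrixWeight.aemeasurable_detRoot (hV : IsMatrixWeight V) :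
    AEMeasurable fun x => detRoot (V x) :=
  hV.aemeasurable_realDet.pow_const _

lemma integrableOn_re_trace_mul {E : Set (Fin n → ℝ)}
    (hE : ∀ i j, IntegrableOn (fun x => V x i j) E) (N : Matrix (Fin d) (Fin d) 𝕜) :
    IntegrableOn (fun x => RCLike.re (N * V x).trace) E := by
  simp only [Matrix.trace, Matrix.diag, Matrix.mul_apply]
  exact Integrable.re (integrable_finsetSum _ fun i _ => integrable_finsetSum _ fun j _ =>
    (hE j i).const_mul _)

lemma integral_re_trace_mul {E : Set (Fin n → ℝ)}
    (hE : ∀ i j, IntegrableOn (fun x => V x i j) E) (N : Matrix (Fin d) (Fin d) 𝕜) :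
    ∫ x in E, RCLike.re (N * V x).trace = RCLike.re (N * integralOn V E).trace := by
  simp only [Matrix.trace, Matrix.diag, Matrix.mul_apply, integralOn, Matrix.of_apply]
  have h (i j) : IntegrableOn (fun x => N i j * V x j i) E := (hE j i).const_mul _
  rw [integral_re (integrable_finsetSum _ fun i _ => integrable_finsetSum _ fun j _ => h i j),
    integral_finsetSum _ fun i _ => integrable_finsetSum _ fun j _ => h i j]
  congr 1
  refine Finset.sum_congr rfl fun i _ => ?_
  rw [integral_finsetSum _ fun j _ => h i j]
  exact Finset.sum_congr rfl fun j _ => integral_const_mul _ _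

/-- Makes quadratic forms a special case of the trace integrals, with the rank-one matrix `e eᴴ` as
multiplier. -/
lemma trace_vecMulVec_mul_eq (A : Matrix (Fin d) (Fin d) 𝕜) (e : Fin d → 𝕜) :
    (vecMulVec e (star e) * A).trace = star e ⬝ᵥ A *ᵥ e := by
  rw [vecMulVec_mul, trace_vecMulVec, dotProduct_comm, dotProduct_mulVec]

lemma integrableOn_re_dotProduct_mulVec {E : Set (Fin n → ℝ)}
    (hE : ∀ i j, IntegrableOn (fun x => V x i j) E) (e : Fin d → 𝕜) :
    IntegrableOn (fun x => RCLike.re (star e ⬝ᵥ V x *ᵥ e)) E := by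
  simpa only [trace_vecMulVec_mul_eq] using integrableOn_re_trace_mul hE (vecMulVec e (star e))

lemma integral_re_dotProduct_mulVec {E : Set (Fin n → ℝ)}
    (hE : ∀ i j, IntegrableOn (fun x => V x i j) E) (e : Fin d → 𝕜) :
    ∫ x in E, RCLike.re (star e ⬝ᵥ V x *ᵥ e) = RCLike.re (star e ⬝ᵥ integralOn V E *ᵥ e) := by
  simpa only [trace_vecMulVec_mul_eq] using integral_re_trace_mul hE (vecMulVec e (star e))

lemma averageOn_eq (V : (Fin n → ℝ) → Matrix (Fin d) (Fin d) 𝕜) (Q : Set (Fin n → ℝ)) :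
    averageOn V Q = (volume.real Q)⁻¹ • integralOn V Q := by
  ext i j
  simp [averageOn, integralOn, setAverage_eq]

lemma IsND.posDef_averageOn (hV : IsND V) (z : Fin n → ℝ) {r : ℝ} (hr : 0 < r) :
    (averageOn V (cube z r)).PosDef := by
  rw [averageOn_eq]
  have h := hV.posDef_integralOn _ (measurableSet_cube z r) (volume_cube_pos z hr)
    (hV.isMatrixWeight.integrableOn_cube z r)
  exact h.smul (inv_pos.2 (volume_real_cube_pos z hr))

/-- By linearity the average is `tr (M⁻¹ M)`. This normalization is what makes the pointwise trace
inequalities useful after averaging. -/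
lemma IsND.average_trace (hV : IsND V) (z : Fin n → ℝ) {r : ℝ} (hr : 0 < r) :
    ⨍ x in cube z r, RCLike.re ((averageOn V (cube z r))⁻¹ * V x).trace = d := by
  have hM := (hV.posDef_averageOn z hr).isUnit
  rw [setAverage_eq, integral_re_trace_mul (hV.isMatrixWeight.integrableOn_cube z r), smul_eq_mul,
    ← RCLike.smul_re, ← Matrix.trace_smul, ← Matrix.mul_smul, ← averageOn_eq,
    nonsing_inv_mul _ ((isUnit_iff_isUnit_det _).1 hM), trace_one, Fintype.card_fin,
    RCLike.natCast_re]

/-! ### Pointwise and integral forms of nondegeneracy. -/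

/-- Integral form of nondegeneracy from the pointwise form. -/
lemma isND_of_ae_pos (hV : IsMatrixWeight V)
    (h : ∀ e : Fin d → 𝕜, e ≠ 0 → ∀ᵐ x, 0 < RCLike.re (star e ⬝ᵥ V x *ᵥ e)) : IsND V := by
  refine ⟨hV, fun E hE hE0 hint => ?_⟩
  have hherm : (integralOn V E).IsHermitian := by
    ext i j
    rw [conjTranspose_apply, integralOn, of_apply, of_apply, RCLike.star_def, ← integral_conj]
    refine integral_congr_ae ((ae_restrict_of_ae hV.posSemidef).mono fun x hx => ?_)
    exact hx.1.apply i j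
  refine PosDef.of_dotProduct_mulVec_pos hherm fun e he => ?_
  rw [RCLike.pos_iff]
  refine ⟨?_, hherm.im_star_dotProduct_mulVec_self e⟩
  have hpos : ∀ᵐ x ∂volume.restrict E, 0 < RCLike.re (star e ⬝ᵥ V x *ᵥ e) :=
    ae_restrict_of_ae (h e he)
  rw [← integral_re_dotProduct_mulVec hint, integral_pos_iff_support_of_nonneg_ae
    (hpos.mono fun _ hx => hx.le) (integrableOn_re_dotProduct_mulVec hint e)]
  have h0 : (volume.restrict E)
      (Function.support fun x => RCLike.re (star e ⬝ᵥ V x *ᵥ e))ᶜ = 0 :=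
    measure_mono_null (fun x hx (hlt : 0 < RCLike.re (star e ⬝ᵥ V x *ᵥ e)) => hx hlt.ne')
      (ae_iff.1 hpos)
  rwa [measure_of_measure_compl_eq_zero h0, Measure.restrict_apply_univ]

lemma iUnion_cube_nat : ⋃ k : ℕ, cube (0 : Fin n → ℝ) (k + 1) = Set.univ := by
  refine Set.eq_univ_of_univ_subset ?_
  rw [← Metric.iUnion_closedBall_nat (0 : Fin n → ℝ)]
  exact Set.iUnion_mono fun k => Metric.closedBall_subset_closedBall (by linarith)

lemma ae_of_forall_measure_cube_inter {p : (Fin n → ℝ) → Prop}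
    (h : ∀ k : ℕ, volume ({x | ¬ p x} ∩ cube 0 (k + 1)) = 0) : ∀ᵐ x, p x := by
  rw [ae_iff, ← Set.inter_univ {x | ¬ p x}, ← iUnion_cube_nat, Set.inter_iUnion]
  exact measure_iUnion_null h

/-- Pointwise form of nondegeneracy from the integral form. -/
lemma IsND.ae_pos (hV : IsND V) (e : Fin d → 𝕜) (he : e ≠ 0) :
    ∀ᵐ x, 0 < RCLike.re (star e ⬝ᵥ V x *ᵥ e) := by
  refine ae_of_forall_measure_cube_inter fun k => ?_
  by_contra hne
  set Q : Set (Fin n → ℝ) := cube 0 (k + 1)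
  have hQ := hV.isMatrixWeight.integrableOn_cube (0 : Fin n → ℝ) (k + 1)
  have hnull : NullMeasurableSet ({x | ¬ 0 < RCLike.re (star e ⬝ᵥ V x *ᵥ e)} ∩ Q) := by
    have hm : AEMeasurable (fun x => RCLike.re (star e ⬝ᵥ V x *ᵥ e)) (volume.restrict Q) :=
      (integrableOn_re_dotProduct_mulVec hQ e).aestronglyMeasurable.aemeasurable
    rw [← nullMeasurableSet_restrict_of_subset Set.inter_subset_right]
    refine NullMeasurableSet.inter ?_ (measurableSet_cube _ _).nullMeasurableSet
    simp only [not_lt]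
    exact nullMeasurableSet_le hm aemeasurable_const
  -- The bad set is only known to be null measurable, while nondegeneracy speaks of measurable sets.
  -- Since `E` lies in a cube, `V` is integrable on it.
  obtain ⟨E, hEsub, hE, hEeq⟩ := hnull.exists_measurable_subset_ae_eq
  have hEint : ∀ i j, IntegrableOn (fun x => V x i j) E := fun i j =>
    (hQ i j).mono_set (hEsub.trans Set.inter_subset_right)
  have hE0 : 0 < volume E := by rw [measure_congr hEeq]; exact pos_iff_ne_zero.2 hne
  have h1 := (RCLike.pos_iff.1 ((hV.posDef_integralOn E hE hE0 hEint).dotProduct_mulVec_pos he)).1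
  rw [← integral_re_dotProduct_mulVec hEint] at h1
  have h2 : ∫ x in E, RCLike.re (star e ⬝ᵥ V x *ᵥ e) ≤ 0 :=
    setIntegral_nonpos hE fun x hx => not_lt.1 (hEsub hx).1
  linarith

lemma IsMatrixWeight.locallyIntegrable_detRoot (hd : 1 ≤ d) (hV : IsMatrixWeight V) :
    LocallyIntegrable fun x => detRoot (V x) := by
  have htr : LocallyIntegrable fun x => RCLike.re (1 * V x).trace / (d : ℝ) := by
    rw [locallyIntegrable_iff]
    intro K hK
    exact (integrableOn_re_trace_mul
      (fun i j => (hV.locallyIntegrable i j).integrableOn_isCompact hK) 1).div_const _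
  refine htr.mono hV.aemeasurable_detRoot.aestronglyMeasurable ?_
  filter_upwards [hV.posSemidef] with x hx
  have h := detRoot_le_mul_trace hd (PosDef.one (n := Fin d) (R := 𝕜)) hx
  rw [detRoot_one, one_mul, inv_one] at h
  rw [Real.norm_of_nonneg (detRoot_nonneg hx)]
  exact h.trans (le_abs_self _)

/-- The direct Brunn–Minkowski direction: AM–GM relative to the fixed matrix `⟨V⟩_Q` is integrated
over `Q`, and the trace averages to `d`. -/
lemma IsND.average_detRoot_le (hd : 1 ≤ d) (hV : IsND V) (z : Fin n → ℝ) {r : ℝ} (hr : 0 < r) :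
    ⨍ x in cube z r, detRoot (V x) ≤ detRoot (averageOn V (cube z r)) := by
  have hM := hV.posDef_averageOn z hr
  set M := averageOn V (cube z r) with hMdef
  have hd0 : (d : ℝ) ≠ 0 := by positivity
  have h1 : ∫ x in cube z r, detRoot (V x) ≤
      ∫ x in cube z r, detRoot M / d * RCLike.re (M⁻¹ * V x).trace := by
    refine integral_mono_ae (integrableOn_cube_of_locallyIntegrable
      (hV.isMatrixWeight.locallyIntegrable_detRoot hd) z r) ((integrableOn_re_trace_mul
      (hV.isMatrixWeight.integrableOn_cube z r) M⁻¹).const_mul _) ?_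
    filter_upwards [ae_restrict_of_ae hV.isMatrixWeight.posSemidef] with x hx
    refine (detRoot_le_mul_trace hd hM hx).trans (le_of_eq ?_)
    ring
  rw [integral_const_mul, setIntegral_cube_eq _ z hr, setIntegral_cube_eq _ z hr, hMdef,
    hV.average_trace z hr, ← hMdef] at h1
  refine le_of_mul_le_mul_left (h1.trans (le_of_eq ?_)) (volume_real_cube_pos z hr)
  field_simp

end Integrals

/-! ### The equivalences -/

section Equivalence

open Matrix

variable {n d : ℕ} {𝕜 : Type*} [RCLike 𝕜] {V : (Fin n → ℝ) → Matrix (Fin d) (Fin d) 𝕜}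

lemma IsA2Inf.isND (h : IsA2Inf V) : IsND V :=
  isND_of_ae_pos h.isMatrixWeight h.nondegenerate

theorem IsA2Inf.isAInf (h : IsA2Inf V) : IsAInf V := by
  refine ⟨h.isMatrixWeight, fun ε hε => ?_⟩
  obtain ⟨A, hA, hAle⟩ := h.det_le
  set L := max (Real.log A) 0 with hL
  -- Chosen so that `-1 - log δ = (L + 1) / ε`; Markov then bounds the bad set by `ε L / (L + 1)`
  -- times the volume. The added `1` keeps the threshold positive when `L = 0`.
  refine ⟨Real.exp (-1 - (L + 1) / ε), Real.exp_pos _, fun z r hr => ?_⟩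
  set δ := Real.exp (-1 - (L + 1) / ε) with hδ
  have hM := h.isND.posDef_averageOn z hr
  have hle := hAle z r hr
  have htr := h.isND.average_trace z hr
  set M := averageOn V (cube z r)
  have hM0 := realDet_pos hM
  have hv := volume_real_cube_pos z hr
  rw [expAverageLog] at hle
  split_ifs at hle with hcond
  swap
  -- Here `expAverageLog` takes its default value `0`, contradicting `det M > 0`.
  · linarith
  obtain ⟨hpos, hlogint⟩ := hcond
  have hlog := Real.log_le_log hM0 hle
  rw [Real.log_mul hA.ne' (Real.exp_pos _).ne', Real.log_exp] at hlog
  have hi1 := integrableOn_re_trace_mul (h.isMatrixWeight.integrableOn_cube z r) M⁻¹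
  have hi2 : IntegrableOn (fun x => Real.log (realDet (V x)) - Real.log (realDet M)) (cube z r) :=
    hlogint.sub (integrable_const _)
  have hi12 : IntegrableOn (fun x => RCLike.re (M⁻¹ * V x).trace -
      (Real.log (realDet (V x)) - Real.log (realDet M))) (cube z r) := hi1.sub hi2
  have hi3 : IntegrableOn (fun x => RCLike.re (M⁻¹ * V x).trace -
      (Real.log (realDet (V x)) - Real.log (realDet M)) - d) (cube z r) :=
    hi12.sub (integrable_const _)
  have hint : ∫ x in cube z r, (RCLike.re (M⁻¹ * V x).trace -
      (Real.log (realDet (V x)) - Real.log (realDet M)) - d) ≤ L * volume.real (cube z r) := by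
    rw [integral_sub hi12 (integrable_const _), integral_sub hi1 hi2,
      integral_sub hlogint (integrable_const _), setIntegral_const, setIntegral_const,
      setIntegral_cube_eq _ z hr, setIntegral_cube_eq _ z hr, htr, smul_eq_mul, smul_eq_mul]
    have h1 : Real.log A ≤ L := le_max_left _ _
    have h2 := mul_le_mul_of_nonneg_left (hlog.trans (add_le_add_left h1 _)) hv.le
    linarith
  have hae : ∀ᵐ x ∂volume.restrict (cube z r), (V x).PosSemidef ∧ 0 < realDet (V x) :=
    (ae_restrict_of_ae h.isMatrixWeight.posSemidef).and hpos
  have hmarkov := mul_meas_ge_le_integral_of_nonneg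
    (hae.mono fun x hx => (trace_sub_log_det_ge hM hx.1 hx.2).1) hi3 ((L + 1) / ε)
  have hbad : (volume.restrict (cube z r)).real {x | ¬ (V x - δ • M).PosSemidef} ≤
      (volume.restrict (cube z r)).real {x | (L + 1) / ε ≤ RCLike.re (M⁻¹ * V x).trace -
        (Real.log (realDet (V x)) - Real.log (realDet M)) - d} := by
    refine ENNReal.toReal_mono (measure_ne_top _ _) (measure_mono_ae ?_)
    filter_upwards [hae] with x hx hxbad
    have h1 := (trace_sub_log_det_ge hM hx.1 hx.2).2 δ (Real.exp_pos _) hxbad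
    rw [hδ, Real.log_exp] at h1
    refine le_trans (le_of_eq ?_) h1
    ring
  have hL0 : 0 ≤ L := le_max_right _ _
  have hbad2 : (volume.restrict (cube z r)).real {x | ¬ (V x - δ • M).PosSemidef} ≤
      ε * volume.real (cube z r) := by
    have h1 := (mul_le_mul_of_nonneg_left hbad (by positivity : 0 ≤ (L + 1) / ε)).trans
      (hmarkov.trans hint)
    rw [div_mul_eq_mul_div, div_le_iff₀ hε] at h1
    have h2 : (L + 1) * (volume.restrict (cube z r)).real {x | ¬ (V x - δ • M).PosSemidef} ≤
        (L + 1) * (ε * volume.real (cube z r)) := by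
      nlinarith [mul_pos hv hε]
    exact le_of_mul_le_mul_left h2 (by linarith)
  have hgood : volume.real {x ∈ cube z r | (V x - δ • M).PosSemidef} =
      (volume.restrict (cube z r)).real {x | (V x - δ • M).PosSemidef} := by
    rw [measureReal_def, measureReal_def, Measure.restrict_apply' (measurableSet_cube _ _),
      Set.inter_comm]
    rfl
  -- Subadditivity gives the lower bound for the good set without its measurability.
  have hsum := measureReal_union_le (μ := volume.restrict (cube z r))
    {x | (V x - δ • M).PosSemidef} {x | ¬ (V x - δ • M).PosSemidef}
  have huniv : {x | (V x - δ • M).PosSemidef} ∪ {x | ¬ (V x - δ • M).PosSemidef} = Set.univ :=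
    Set.union_compl_self _
  rw [huniv, measureReal_def, Measure.restrict_apply_univ, ← measureReal_def] at hsum
  rw [hgood]
  linarith

lemma IsAInf.measure_detRoot_le (hd : 1 ≤ d) (hND : IsND V) (h : IsAInf V) {ε : ℝ} (hε : 0 < ε) :
    ∃ δ : ℝ, 0 < δ ∧ ∀ (z : Fin n → ℝ) (r : ℝ), 0 < r →
      (1 - ε) * volume.real (cube z r) ≤
        volume.real ({x | δ * detRoot (averageOn V (cube z r)) ≤ detRoot (V x)} ∩ cube z r) := by
  obtain ⟨δ, hδ, H⟩ := h.measure_le ε hε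
  refine ⟨δ, hδ, fun z r hr => (H z r hr).trans ?_⟩
  refine measureReal_mono (fun x hx => ⟨?_, hx.1⟩)
    (measure_ne_top_of_subset Set.inter_subset_right (volume_cube_ne_top z r))
  exact mul_detRoot_le hd (hND.posDef_averageOn z hr) hδ hx.2

/-- In each cube `Q` the threshold `δ (det ⟨V⟩_Q)^{1/d}` is positive, so the zero set fills at most
a fraction `ε` of `Q`, for every `ε`. -/
lemma IsAInf.ae_detRoot_pos (hd : 1 ≤ d) (hND : IsND V) (h : IsAInf V) :
    ∀ᵐ x, 0 < detRoot (V x) := by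
  refine ae_of_forall_measure_cube_inter fun k => ?_
  have hr : (0 : ℝ) < k + 1 := by positivity
  set Q : Set (Fin n → ℝ) := cube 0 (k + 1) with hQ
  have hfin : volume ({x | ¬ 0 < detRoot (V x)} ∩ Q) ≠ ⊤ :=
    measure_ne_top_of_subset Set.inter_subset_right (volume_cube_ne_top _ _)
  rw [← measureReal_eq_zero_iff hfin]
  refine le_antisymm ?_ measureReal_nonneg
  have hv : 0 < volume.real Q := volume_real_cube_pos _ hr
  refine le_of_forall_pos_le_add fun η hη => ?_
  obtain ⟨δ, hδ, H⟩ := h.measure_detRoot_le hd hND (ε := η / volume.real Q) (by positivity)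
  have h1 := H 0 _ hr
  have hnull : NullMeasurableSet {x | 0 < detRoot (V x)} :=
    nullMeasurableSet_lt aemeasurable_const h.isMatrixWeight.aemeasurable_detRoot
  have h2 := measureReal_inter_add_sdiff₀ (μ := volume) (s := Q) hnull (volume_cube_ne_top _ _)
  have h3 : volume.real ({x | δ * detRoot (averageOn V Q) ≤ detRoot (V x)} ∩ Q) ≤
      volume.real (Q ∩ {x | 0 < detRoot (V x)}) := by
    refine measureReal_mono (fun x hx => ⟨hx.2, ?_⟩)
      (measure_ne_top_of_subset Set.inter_subset_left (volume_cube_ne_top _ _))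
    exact lt_of_lt_of_le (mul_pos hδ (detRoot_pos (hND.posDef_averageOn 0 hr))) hx.1
  have h4 : Q \ {x | 0 < detRoot (V x)} = {x | ¬ 0 < detRoot (V x)} ∩ Q := by
    ext x; simp [and_comm]
  rw [h4] at h2
  rw [← hQ, sub_mul, div_mul_cancel₀ _ hv.ne'] at h1
  linarith

theorem IsAInf.isScalarAInf_detRoot (hd : 1 ≤ d) (hND : IsND V) (h : IsAInf V) :
    IsScalarAInf fun x => detRoot (V x) := by
  refine ⟨h.isMatrixWeight.locallyIntegrable_detRoot hd, h.ae_detRoot_pos hd hND, fun ε hε => ?_⟩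
  obtain ⟨δ, hδ, H⟩ := h.measure_detRoot_le hd hND hε
  refine ⟨δ, hδ, fun z r hr => (H z r hr).trans ?_⟩
  refine measureReal_mono (fun x hx => ⟨hx.2, ?_⟩)
    (measure_ne_top_of_subset (fun x hx => hx.1) (volume_cube_ne_top z r))
  -- The threshold with the root of the determinant of the average dominates the one with the
  -- average of the roots.
  exact (mul_le_mul_of_nonneg_left (hND.average_detRoot_le hd z hr) hδ.le).trans hx.1

theorem IsAInf.isRBM (hd : 1 ≤ d) (hND : IsND V) (h : IsAInf V) : IsRBM V := by
  obtain ⟨δ, hδ, H⟩ := h.measure_detRoot_le hd hND (ε := 1 / 2) (by norm_num)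
  refine ⟨h.isMatrixWeight, 2 / δ, by positivity, fun z r hr => ?_⟩
  have h1 := H z r hr
  have h2 := mul_measureReal_ge_le_integral (h.isMatrixWeight.locallyIntegrable_detRoot hd)
    (h.ae_detRoot_pos hd hND) (δ * detRoot (averageOn V (cube z r))) z r
  have hm := detRoot_pos (hND.posDef_averageOn z hr)
  have h3 := (mul_le_mul_of_nonneg_left h1 (mul_pos hδ hm).le).trans h2
  rw [setIntegral_cube_eq _ z hr] at h3
  have h4 : δ * detRoot (averageOn V (cube z r)) / 2 ≤ ⨍ x in cube z r, detRoot (V x) :=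
    le_of_mul_le_mul_left (le_trans (le_of_eq (by ring)) h3) (volume_real_cube_pos z hr)
  rw [div_mul_eq_mul_div, le_div_iff₀ hδ]
  linarith

theorem IsND.isA2Inf (hd : 1 ≤ d) (hND : IsND V) (hRBM : IsRBM V)
    (hw : IsScalarAInf fun x => detRoot (V x)) : IsA2Inf V := by
  refine ⟨hND.isMatrixWeight, hND.ae_pos, ?_⟩
  obtain ⟨B, hB, hBle⟩ := hRBM.detRoot_le
  obtain ⟨C, hC⟩ := hw.average_log_ge
  -- The constant is `(B e^C)^d`: `B` is lost in reverse Brunn–Minkowski, `e^C` in reverse Jensen,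
  -- and the power `d` undoes the root.
  refine ⟨Real.exp (d * (Real.log B + C)), Real.exp_pos _, fun z r hr => ?_⟩
  obtain ⟨hint, hge⟩ := hC z r hr
  have hd0 : (d : ℝ) ≠ 0 := by positivity
  have hM := realDet_pos (hND.posDef_averageOn z hr)
  have hpos : ∀ᵐ x, 0 < realDet (V x) := by
    filter_upwards [hw.pos, hND.isMatrixWeight.posSemidef] with x hx hps
    refine lt_of_le_of_ne (realDet_nonneg hps) fun h0 => hx.ne' ?_
    rw [detRoot, ← h0, Real.zero_rpow (by positivity)]
  have hlog : ∀ᵐ x ∂volume.restrict (cube z r),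
      d * Real.log (detRoot (V x)) = Real.log (realDet (V x)) := by
    filter_upwards [ae_restrict_of_ae hpos] with x hx
    rw [detRoot, Real.log_rpow hx]
    field_simp
  have hint' : IntegrableOn (fun x => Real.log (realDet (V x))) (cube z r) :=
    (hint.const_mul (d : ℝ)).congr hlog
  rw [expAverageLog, if_pos ⟨ae_restrict_of_ae hpos, hint'⟩, ← Real.exp_add,
    ← Real.log_le_iff_le_exp hM]
  have havg : ⨍ x in cube z r, Real.log (realDet (V x)) =
      d * ⨍ x in cube z r, Real.log (detRoot (V x)) := by
    rw [setAverage_eq, setAverage_eq, ← integral_congr_ae hlog, integral_const_mul, smul_eq_mul,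
      smul_eq_mul]
    ring
  have hwpos := setAverage_pos_of_ae_pos hw.locallyIntegrable hw.pos z hr
  have h1 := Real.log_le_log (detRoot_pos (hND.posDef_averageOn z hr)) (hBle z r hr)
  rw [Real.log_mul hB.ne' hwpos.ne', detRoot, Real.log_rpow hM, one_div_mul_eq_div,
    div_le_iff₀ (by positivity)] at h1
  rw [havg]
  have h2 : (d : ℝ) * (Real.log (⨍ x in cube z r, detRoot (V x)) - C) ≤
      d * ⨍ x in cube z r, Real.log (detRoot (V x)) := mul_le_mul_of_nonneg_left hge (by positivity)
  linarith

end Equivalence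

end MatrixWeight

theorem propositionB14 {𝕜 : Type*} [RCLike 𝕜] (n d : ℕ) (hn : 1 ≤ n) (hd : 1 ≤ d) :
    (∀ V : (Fin n → ℝ) → Matrix (Fin d) (Fin d) 𝕜, MatrixWeight.IsND V →
      List.TFAE
        [MatrixWeight.IsA2Inf V,
         MatrixWeight.IsAInf V,
         MatrixWeight.IsRBM V ∧
           MatrixWeight.IsScalarAInf (fun x => MatrixWeight.detRoot (V x))]) ∧
    {V : (Fin n → ℝ) → Matrix (Fin d) (Fin d) 𝕜 | MatrixWeight.IsA2Inf V} =
      {V : (Fin n → ℝ) → Matrix (Fin d) (Fin d) 𝕜 |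
        MatrixWeight.IsND V ∧ MatrixWeight.IsAInf V} := by
  have hba {V : (Fin n → ℝ) → Matrix (Fin d) (Fin d) 𝕜} (hV : MatrixWeight.IsND V)
      (h : MatrixWeight.IsAInf V) : MatrixWeight.IsA2Inf V :=
    hV.isA2Inf hd (h.isRBM hd hV) (h.isScalarAInf_detRoot hd hV)
  refine ⟨fun V hV => ?_, Set.ext fun V => ⟨fun h => ⟨h.isND, h.isAInf⟩, fun h => hba h.1 h.2⟩⟩
  tfae_have 1 → 2 := fun h => h.isAInf
  tfae_have 2 → 3 := fun h => ⟨h.isRBM hd hV, h.isScalarAInf_detRoot hd hV⟩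
  tfae_have 3 → 1 := fun h => hV.isA2Inf hd h.1 h.2
  tfae_finish
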